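/- Let $\mu>-\pi^2$ and let $\phi$ be the (nonlinear) ground state, i.e. the positive solution of $$-\phi''+\mu\phi-\phi^3=0\quad\text{in }(0,1),\qquad \phi(0)=\phi(1)=0$$ ($\phi$ real-valued, continuous on $[0,1]$, twice continuously differentiable and strictly positive on $(0,1)$). Let $$L_+=-\frac{d^2}{dx^2}+\mu-3\phi^2$$ be the Sturm–Liouville operator in the complex Hilbert space $L^2(0,1)$ with zero Dirichlet boundary conditions, i.e. with domain $H^2(0,1)\cap H^1_0(0,1)$. Then $L_+$ has exactly one negative eigenvalue (whose eigenspace is one-dimensional), and all its other eigenvalues are (real and) positive. In particular, $\ker L_+=\{0\}$. -/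

import Mathlib

open MeasureTheory Set

/-- `φ` is a ground state for the parameter `μ`: a classical solution, positive in `(0,1)`, of
`-φ'' + μ φ - φ³ = 0` in `(0,1)` with `φ(0) = φ(1) = 0`. -/
structure IsGroundState (μ : ℝ) (φ : ℝ → ℝ) : Prop where
  continuousOn : ContinuousOn φ (Icc 0 1)
  contDiffOn : ContDiffOn ℝ 2 φ (Ioo 0 1)
  equation : ∀ x ∈ Ioo (0 : ℝ) 1, -(deriv (deriv φ) x) + μ * φ x - φ x ^ 3 = 0
  left_zero : φ 0 = 0
  right_zero : φ 1 = 0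
  pos : ∀ x ∈ Ioo (0 : ℝ) 1, 0 < φ x

/-- Lebesgue measure on the interval `(0,1)`. -/
noncomputable abbrev unitMeasure : Measure ℝ := volume.restrict (Ioo 0 1)

/-- The complex Hilbert space `L²(0,1)`. -/
abbrev L2Unit : Type := Lp ℂ 2 unitMeasure

/-- `u` lies in `H²(0,1) ∩ H¹₀(0,1)` and `u'' = w` in `L²(0,1)`: `u` has a representative `U` that is
differentiable on `[0,1]` with `U(0) = U(1) = 0`, and whose derivative `V` is absolutely continuous
on `[0,1]` with almost everywhere derivative `w ∈ L²(0,1)`, i.e. `V` is a primitive of `w`. -/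
def HasDirichletSecondDeriv (u w : L2Unit) : Prop :=
  ∃ U V : ℝ → ℂ, (∀ᵐ x ∂unitMeasure, u x = U x) ∧
    (∀ x ∈ Icc (0 : ℝ) 1, HasDerivWithinAt U (V x) (Icc 0 1) x) ∧
    (∀ x ∈ Icc (0 : ℝ) 1, V x = V 0 + ∫ s in (0 : ℝ)..x, w s) ∧
    U 0 = 0 ∧ U 1 = 0

theorem L2Unit.intervalIntegrable (w : L2Unit) {x : ℝ} (hx : x ∈ Icc (0 : ℝ) 1) :
    IntervalIntegrable w volume 0 x := by
  have h : Integrable w unitMeasure := (Lp.memLp w).integrable (by norm_num)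
  rw [intervalIntegrable_iff_integrableOn_Ioo_of_le hx.1]
  exact IntegrableOn.mono_set h (Ioo_subset_Ioo le_rfl hx.2)

/-- The graph of the Dirichlet second derivative, as a subspace of `L² × L²`. -/
def dirichletSecondDerivGraph : Submodule ℂ (L2Unit × L2Unit) where
  carrier := {p | HasDirichletSecondDeriv p.1 p.2}
  zero_mem' := by
    refine ⟨fun _ => 0, fun _ => 0, ?_, fun x _ => hasDerivWithinAt_const _ _ _, ?_, rfl, rfl⟩
    · filter_upwards [Lp.coeFn_zero ℂ 2 unitMeasure] with x hx using hx
    · intro x hx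
      have h0 : ∀ᵐ s ∂(volume.restrict (Ioo (0 : ℝ) 1)), (0 : L2Unit) s = 0 := by
        filter_upwards [Lp.coeFn_zero ℂ 2 unitMeasure] with x hx using hx
      have : ∫ s in (0 : ℝ)..x, (0 : L2Unit) s = 0 := by
        rw [intervalIntegral.integral_of_le hx.1, integral_Ioc_eq_integral_Ioo]
        refine integral_eq_zero_of_ae ?_
        exact ae_restrict_of_ae_restrict_of_subset (Ioo_subset_Ioo le_rfl hx.2) h0
      simpa using this.symm
  add_mem' := by
    rintro ⟨u, w⟩ ⟨u', w'⟩ ⟨U, V, h1, h2, h3, h4, h5⟩ ⟨U', V', h1', h2', h3', h4', h5'⟩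
    refine ⟨fun x => U x + U' x, fun x => V x + V' x, ?_, fun x hx => (h2 x hx).add (h2' x hx),
      ?_, by simp [h4, h4'], by simp [h5, h5']⟩
    · filter_upwards [Lp.coeFn_add u u', h1, h1'] with x hx e e'
      have hx' : (u + u') x = u x + u' x := hx
      change (u + u') x = _
      rw [hx', e, e']
    · intro x hx
      have h0 : ∀ᵐ s ∂(volume.restrict (Ioo (0 : ℝ) 1)), (w + w') s = w s + w' s := by
        filter_upwards [Lp.coeFn_add w w'] with x hx using hx
      have : ∫ s in (0 : ℝ)..x, (w + w') s = ∫ s in (0 : ℝ)..x, (w s + w' s) := by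
        rw [intervalIntegral.integral_of_le hx.1, intervalIntegral.integral_of_le hx.1,
          integral_Ioc_eq_integral_Ioo, integral_Ioc_eq_integral_Ioo]
        exact integral_congr_ae
          (ae_restrict_of_ae_restrict_of_subset (Ioo_subset_Ioo le_rfl hx.2) h0)
      change V x + V' x = V 0 + V' 0 + ∫ s in (0 : ℝ)..x, (w + w') s
      rw [this, intervalIntegral.integral_add (w.intervalIntegrable hx) (w'.intervalIntegrable hx),
        h3 x hx, h3' x hx]
      ring
  smul_mem' := by
    rintro c ⟨u, w⟩ ⟨U, V, h1, h2, h3, h4, h5⟩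
    refine ⟨fun x => c * U x, fun x => c * V x, ?_, fun x hx => (h2 x hx).const_mul c,
      ?_, by simp [h4], by simp [h5]⟩
    · filter_upwards [Lp.coeFn_smul c u, h1] with x hx e
      have hx' : (c • u) x = c * u x := hx
      change (c • u) x = _
      rw [hx', e]
    · intro x hx
      have h0 : ∀ᵐ s ∂(volume.restrict (Ioo (0 : ℝ) 1)), (c • w) s = c * w s := by
        filter_upwards [Lp.coeFn_smul c w] with x hx using hx
      have : ∫ s in (0 : ℝ)..x, (c • w) s = ∫ s in (0 : ℝ)..x, c * w s := by
        rw [intervalIntegral.integral_of_le hx.1, intervalIntegral.integral_of_le hx.1,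
          integral_Ioc_eq_integral_Ioo, integral_Ioc_eq_integral_Ioo]
        exact integral_congr_ae
          (ae_restrict_of_ae_restrict_of_subset (Ioo_subset_Ioo le_rfl hx.2) h0)
      change c * V x = c * V 0 + ∫ s in (0 : ℝ)..x, (c • w) s
      rw [this, intervalIntegral.integral_const_mul, h3 x hx]
      ring

/-- The second derivative of an element of `H² ∩ H¹₀` is unique. -/
theorem dirichletSecondDerivGraph_snd_eq_zero (p : L2Unit × L2Unit)
    (hp : p ∈ dirichletSecondDerivGraph) (h0 : p.1 = 0) : p.2 = 0 := by
  obtain ⟨u, w⟩ := p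
  obtain ⟨U, V, h1, h2, h3, h4, h5⟩ := hp
  change u = 0 at h0
  change w = 0
  subst h0
  have hUc : ContinuousOn U (Icc 0 1) := fun x hx => (h2 x hx).continuousWithinAt
  have hae : U =ᵐ[volume.restrict (Icc (0 : ℝ) 1)] fun _ => (0 : ℂ) := by
    rw [← restrict_Ioo_eq_restrict_Icc]
    filter_upwards [Lp.coeFn_zero ℂ 2 unitMeasure, h1] with x hx e
    exact e.symm.trans hx
  have hU0 : EqOn U (fun _ => (0 : ℂ)) (Icc 0 1) :=
    Measure.eqOn_Icc_of_ae_eq volume (zero_ne_one' ℝ) hae hUc continuousOn_const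
  have hV0 : ∀ x ∈ Icc (0 : ℝ) 1, V x = 0 := fun x hx =>
    (uniqueDiffOn_Icc (zero_lt_one' ℝ) x hx).eq_deriv _ (h2 x hx)
      ((hasDerivWithinAt_const x (Icc (0 : ℝ) 1) (0 : ℂ)).congr hU0 (hU0 hx))
  have hI : ∀ x ∈ Icc (0 : ℝ) 1, ∫ s in (0 : ℝ)..x, w s = 0 := by
    intro x hx
    have h := h3 x hx
    rw [hV0 x hx, hV0 0 (by simp), zero_add] at h
    exact h.symm
  have hd := (w.intervalIntegrable (x := 1) (by simp)).ae_hasDerivAt_integral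
  rw [Lp.eq_zero_iff_ae_eq_zero]
  have hd' : ∀ᵐ x ∂unitMeasure, x ∈ Icc (0 : ℝ) 1 →
      HasDerivAt (fun x => ∫ t in (0 : ℝ)..x, w t) (w x) x := by
    filter_upwards [ae_restrict_of_ae hd] with x hx hx'
    exact hx (by rwa [uIcc_of_le zero_le_one]) 0 (by simp)
  filter_upwards [hd', ae_restrict_mem measurableSet_Ioo] with x hx hm
  refine (hx (Ioo_subset_Icc_self hm)).unique ?_
  refine (hasDerivAt_const x (0 : ℂ)).congr_of_eventuallyEq ?_
  filter_upwards [Ioo_mem_nhds hm.1 hm.2] with y hy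
  exact hI y (Ioo_subset_Icc_self hy)

/-- The operator `u ↦ u''` in `L²(0,1)` with domain `H²(0,1) ∩ H¹₀(0,1)`. -/
noncomputable def dirichletSecondDeriv : L2Unit →ₗ.[ℂ] L2Unit :=
  dirichletSecondDerivGraph.toLinearPMap

theorem dirichletSecondDeriv_graph :
    dirichletSecondDeriv.graph = dirichletSecondDerivGraph :=
  Submodule.toLinearPMap_graph_eq _ dirichletSecondDerivGraph_snd_eq_zero

/-- Multiplication by the real function `q` in `L²(0,1)`, on its maximal domain
`{u ∈ L²(0,1) : q u ∈ L²(0,1)}`. -/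
noncomputable def mulPotential (q : ℝ → ℝ) : L2Unit →ₗ.[ℂ] L2Unit where
  domain :=
    { carrier := {u | MemLp (fun x => (q x : ℂ) * u x) 2 unitMeasure}
      zero_mem' := by
        refine (memLp_congr_ae ?_).mpr (MemLp.zero (ε := ℂ))
        filter_upwards [Lp.coeFn_zero ℂ 2 unitMeasure] with x hx
        simp only [hx, Pi.zero_apply, mul_zero]
      add_mem' := by
        intro u v hu hv
        refine (memLp_congr_ae ?_).mpr (MemLp.add hu hv)
        filter_upwards [Lp.coeFn_add u v] with x hx
        simp only [hx, Pi.add_apply, mul_add]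
      smul_mem' := by
        intro c u hu
        refine (memLp_congr_ae ?_).mpr (MemLp.const_smul hu c)
        filter_upwards [Lp.coeFn_smul c u] with x hx
        simp only [hx, Pi.smul_apply, smul_eq_mul]
        ring }
  toFun :=
    { toFun := fun u => MemLp.toLp (fun x => (q x : ℂ) * (u : L2Unit) x) u.2
      map_add' := by
        intro u v
        rw [← MemLp.toLp_add]
        refine (MemLp.toLp_eq_toLp_iff _ _).mpr ?_
        filter_upwards [Lp.coeFn_add (u : L2Unit) (v : L2Unit)] with x hx
        simp only [Submodule.coe_add, hx, Pi.add_apply, mul_add]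
      map_smul' := by
        intro c u
        rw [RingHom.id_apply, ← MemLp.toLp_const_smul]
        refine (MemLp.toLp_eq_toLp_iff _ _).mpr ?_
        filter_upwards [Lp.coeFn_smul c (u : L2Unit)] with x hx
        simp only [Submodule.coe_smul, hx, Pi.smul_apply, smul_eq_mul]
        ring }

/-- The operator `L₊ = -d²/dx² + μ - 3 φ²` in `L²(0,1)` with zero Dirichlet boundary conditions.
For `φ` continuous on `[0,1]` its domain is `H²(0,1) ∩ H¹₀(0,1)`. -/
noncomputable def LPlus (μ : ℝ) (φ : ℝ → ℝ) : L2Unit →ₗ.[ℂ] L2Unit :=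
  -dirichletSecondDeriv + mulPotential (fun x => μ - 3 * φ x ^ 2)

theorem LPlus_domain_eq {μ : ℝ} {φ : ℝ → ℝ} (hφ : ContinuousOn φ (Icc 0 1)) :
    (LPlus μ φ).domain = dirichletSecondDeriv.domain := by
  refine inf_eq_left.mpr fun u _ => ?_
  have hq : ContinuousOn (fun x => ((μ - 3 * φ x ^ 2 : ℝ) : ℂ)) (Icc 0 1) := by fun_prop
  obtain ⟨C, hC⟩ := isCompact_Icc.exists_bound_of_continuousOn hq
  have hm : AEStronglyMeasurable (fun x => ((μ - 3 * φ x ^ 2 : ℝ) : ℂ)) unitMeasure :=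
    (hq.mono Ioo_subset_Icc_self).aestronglyMeasurable measurableSet_Ioo
  refine MemLp.of_le_mul (c := C) (Lp.memLp u) (hm.mul (Lp.aestronglyMeasurable u)) ?_
  filter_upwards [ae_restrict_mem measurableSet_Ioo] with x hx
  rw [norm_mul]
  exact mul_le_mul_of_nonneg_right (hC x (Ioo_subset_Icc_self hx)) (norm_nonneg _)

/-- The eigenspace `{u ∈ D(A) : A u = z u}` of an unbounded operator `A`. -/
def pmapEigenspace {H : Type*} [AddCommGroup H] [Module ℂ H] (A : H →ₗ.[ℂ] H) (z : ℂ) :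
    Submodule ℂ H :=
  (LinearMap.ker (A.toFun - z • A.domain.subtype)).map A.domain.subtype

theorem mem_pmapEigenspace {H : Type*} [AddCommGroup H] [Module ℂ H] (A : H →ₗ.[ℂ] H) (z : ℂ)
    (u : H) : u ∈ pmapEigenspace A z ↔ ∃ h : u ∈ A.domain, A ⟨u, h⟩ = z • u := by
  constructor
  · rintro ⟨v, hv, rfl⟩
    exact ⟨v.2, sub_eq_zero.mp hv⟩
  · rintro ⟨h, e⟩
    exact ⟨⟨u, h⟩, sub_eq_zero.mpr e, rfl⟩

/-- `z` is an eigenvalue of the unbounded operator `A`: there is `u ∈ D(A)`, `u ≠ 0`, with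
`A u = z u`. -/
def IsPMapEigenvalue {H : Type*} [AddCommGroup H] [Module ℂ H] (A : H →ₗ.[ℂ] H) (z : ℂ) : Prop :=
  ∃ u : A.domain, (u : H) ≠ 0 ∧ A u = z • (u : H)

/-!
# The spectrum of the linearization at a ground state

All eigenvalue questions are reduced to the shooting solution `y_r`, which solves
`y'' = (μ - 3 φ² - r) y`, `y(0) = 0`, `y'(0) = 1`: an eigenvalue is real by symmetry
(`IsSturmSolution.im_eq_zero`), and a real `r` is an eigenvalue exactly when `y_r(1) = 0`, in which
case the eigenspace is spanned by `y_r` (`shooting_right_eq_zero`, `exists_span_eigenspace`).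

The function `φ'` solves `L₊ φ' = 0` without the boundary conditions. Conservation of energy shows
that `φ' / φ` is strictly decreasing, so `φ'` is positive on `[0, c)` and negative on `(c, 1]` for
some `c` (`IsGroundState.exists_max_point`). This has two consequences.

* *At most one eigenvalue `≤ 0`.* If `r ≤ 0` and `y_r(1) = 0`, Sturm comparison with `φ'` from the
  left endpoint and with `-φ'` from the right endpoint shows that `y_r` has no zeros in `(0,1)`
  (`IsGroundState.eigenfunction_pos`). Two eigenfunctions of a Sturm–Liouville problem without
  interior zeros belong to the same eigenvalue, by the Wronskian identity
  (`IsGroundState.eigenvalue_unique`).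
* *There is a negative eigenvalue.* If `y_0(1) ≥ 0`, then `y_0 > 0` on `(0, c]` by comparison, and
  on `(c, 1)` because `y_0 / φ'` increases there. The Wronskian of `y_0` and `φ`, whose derivative
  is `-2 φ³ y_0`, then gives `y_0(1) φ'(1) > 0`, which contradicts `φ'(1) < 0`. So `y_0(1) < 0`
  (`IsGroundState.shooting_zero_neg`), whereas `y_r(1) > 0` when `r` is very negative, and
  `r ↦ y_r(1)` is continuous; the intermediate value theorem gives a zero `r < 0`.

The unique eigenvalue `≤ 0` is therefore negative, so `0` is not an eigenvalue. The existence of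
`y_r` and its continuity in `r` come from inverting `1 - T_r` for a quasi-nilpotent Volterra
operator `T_r` on `C([0,1])`.
-/

/-! ### Solutions of `u'' = a u` on the unit interval -/

/-- The functions `u` and `v` satisfy `u' = v` and `v' = a u` on `[0,1]` (with one-sided derivatives
at the endpoints), so `u` is a classical solution of `u'' = a u` and `v` is its derivative. -/
structure IsSturmSolution {𝕜 : Type*} [RCLike 𝕜] (a u v : ℝ → 𝕜) : Prop where
  fst_deriv : ∀ x ∈ Icc (0 : ℝ) 1, HasDerivWithinAt u (v x) (Icc 0 1) x
  snd_deriv : ∀ x ∈ Icc (0 : ℝ) 1, HasDerivWithinAt v (a x * u x) (Icc 0 1) x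

namespace IsSturmSolution

variable {𝕜 : Type*} [RCLike 𝕜] {a b u v y w : ℝ → 𝕜}

theorem continuousOn_fst (h : IsSturmSolution a u v) : ContinuousOn u (Icc 0 1) :=
  fun x hx => (h.fst_deriv x hx).continuousWithinAt

theorem continuousOn_snd (h : IsSturmSolution a u v) : ContinuousOn v (Icc 0 1) :=
  fun x hx => (h.snd_deriv x hx).continuousWithinAt

theorem const_mul (h : IsSturmSolution a u v) (k : 𝕜) :
    IsSturmSolution a (fun x => k * u x) (fun x => k * v x) where
  fst_deriv x hx := (h.fst_deriv x hx).const_mul k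
  snd_deriv x hx := ((h.snd_deriv x hx).const_mul k).congr_deriv (by ring)

theorem sub (h : IsSturmSolution a u v) (h' : IsSturmSolution a y w) :
    IsSturmSolution a (fun x => u x - y x) (fun x => v x - w x) where
  fst_deriv x hx := (h.fst_deriv x hx).sub (h'.fst_deriv x hx)
  snd_deriv x hx := ((h.snd_deriv x hx).sub (h'.snd_deriv x hx)).congr_deriv (by ring)

theorem congr_coeff (h : IsSturmSolution a u v) (hab : ∀ x, a x = b x) :
    IsSturmSolution b u v := by
  rwa [← funext hab]

/-- The reflection `x ↦ 1 - x` of a solution. -/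
theorem reflect (h : IsSturmSolution a u v) :
    IsSturmSolution (fun x => a (1 - x)) (fun x => u (1 - x)) (fun x => -v (1 - x)) := by
  have hr : ∀ x ∈ Icc (0 : ℝ) 1, 1 - x ∈ Icc (0 : ℝ) 1 := fun x hx =>
    ⟨by linarith [hx.2], by linarith [hx.1]⟩
  have hd : ∀ x, HasDerivWithinAt (fun x : ℝ => 1 - x) (-1) (Icc 0 1) x := fun x =>
    ((hasDerivAt_id x).const_sub 1).hasDerivWithinAt
  constructor
  · intro x hx
    exact ((h.fst_deriv (1 - x) (hr x hx)).scomp x (hd x) hr).congr_deriv (by simp)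
  · intro x hx
    exact ((h.snd_deriv (1 - x) (hr x hx)).scomp x (hd x) hr).neg.congr_deriv (by simp)

/-- A solution with vanishing initial data vanishes. -/
theorem eq_zero (h : IsSturmSolution a u v) (ha : ContinuousOn a (Icc 0 1))
    (hu : u 0 = 0) (hv : v 0 = 0) : ∀ x ∈ Icc (0 : ℝ) 1, u x = 0 := by
  obtain ⟨C, hC⟩ := isCompact_Icc.exists_bound_of_continuousOn ha
  have key := norm_le_gronwallBound_of_norm_deriv_right_le (a := 0) (b := 1) (δ := 0)
    (K := max 1 C) (ε := 0) (f := fun x => (u x, v x)) (f' := fun x => (v x, a x * u x))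
    (h.continuousOn_fst.prodMk h.continuousOn_snd) ?_ ?_ ?_
  · intro x hx
    have := key x hx
    rw [gronwallBound_ε0] at this
    simp only [zero_mul, norm_le_zero_iff, Prod.mk_eq_zero] at this
    exact this.1
  · intro x hx
    have hx' : x ∈ Icc (0 : ℝ) 1 := Ico_subset_Icc_self hx
    have hn : Icc (0 : ℝ) 1 ∈ nhdsWithin x (Ici x) :=
      Filter.mem_of_superset (Icc_mem_nhdsGE hx.2) (Icc_subset_Icc_left hx.1)
    exact ((h.fst_deriv x hx').mono_of_mem_nhdsWithin hn).prodMk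
      ((h.snd_deriv x hx').mono_of_mem_nhdsWithin hn)
  · simp [hu, hv]
  · intro x hx
    have h1 := norm_fst_le (u x, v x)
    have h2 := norm_snd_le (u x, v x)
    simp only [add_zero]
    set N := ‖(u x, v x)‖
    have hN : 0 ≤ N := norm_nonneg _
    refine (norm_prod_le_iff).mpr ⟨?_, ?_⟩
    · calc ‖v x‖ ≤ 1 * N := by simpa using h2
        _ ≤ _ := by gcongr; exact le_max_left _ _
    · calc ‖a x * u x‖ = ‖a x‖ * ‖u x‖ := norm_mul _ _
        _ ≤ max 1 C * N := by
          gcongr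
          exact (hC x (Ico_subset_Icc_self hx)).trans (le_max_right _ _)

/-- A solution vanishing at `0` is a multiple of the one with initial data `(0, 1)`. -/
theorem eq_mul_of_left_zero (h : IsSturmSolution a u v) (h' : IsSturmSolution a y w)
    (ha : ContinuousOn a (Icc 0 1)) (hu : u 0 = 0) (hy : y 0 = 0) (hw : w 0 = 1) :
    ∀ x ∈ Icc (0 : ℝ) 1, u x = v 0 * y x := fun x hx =>
  sub_eq_zero.mp ((h.sub (h'.const_mul (v 0))).eq_zero ha (by simp [hu, hy]) (by simp [hw]) x hx)

/-- The derivative of the Wronskian of two solutions. -/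
theorem wronskian (h : IsSturmSolution a u v) (h' : IsSturmSolution b y w) :
    ∀ x ∈ Icc (0 : ℝ) 1, HasDerivWithinAt (fun x => v x * y x - u x * w x)
      ((a x - b x) * (u x * y x)) (Icc 0 1) x := by
  intro x hx
  exact (((h.snd_deriv x hx).mul (h'.fst_deriv x hx)).sub
    ((h.fst_deriv x hx).mul (h'.snd_deriv x hx))).congr_deriv (by ring)

theorem ofReal {a u v : ℝ → ℝ} (h : IsSturmSolution a u v) :
    IsSturmSolution (fun x => (a x : ℂ)) (fun x => (u x : ℂ)) (fun x => (v x : ℂ)) where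
  fst_deriv x hx := (h.fst_deriv x hx).ofReal_comp
  snd_deriv x hx := by simpa using (h.snd_deriv x hx).ofReal_comp

end IsSturmSolution

/-! ### Sturm comparison -/

theorem nonpos_of_hasDerivWithinAt_of_nonneg_left {f : ℝ → ℝ} {m d : ℝ} (hd0 : 0 < d) (hd1 : d ≤ 1)
    (hf : HasDerivWithinAt f m (Icc 0 1) d) (hfd : f d = 0) (hpos : ∀ x ∈ Ioo 0 d, 0 ≤ f x) :
    m ≤ 0 := by
  have h1 : HasDerivWithinAt f m (Ioo 0 d) d :=
    hf.mono fun x hx => ⟨hx.1.le, hx.2.le.trans hd1⟩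
  rw [hasDerivWithinAt_iff_tendsto_slope' (by simp)] at h1
  have : (nhdsWithin d (Ioo 0 d)).NeBot := by
    rw [nhdsWithin_Ioo_eq_nhdsLT hd0]; infer_instance
  refine le_of_tendsto h1 ?_
  filter_upwards [self_mem_nhdsWithin] with x hx
  rw [slope_def_field, hfd, sub_zero]
  exact div_nonpos_of_nonneg_of_nonpos (hpos x hx) (by linarith [hx.2])

/-- A function that leaves the value `0` upwards and is later nonpositive has a first zero. -/
theorem exists_first_zero {f : ℝ → ℝ} {m x₀ : ℝ} (hf : ContinuousOn f (Icc 0 1))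
    (hf0 : HasDerivWithinAt f m (Icc 0 1) 0) (h0 : f 0 = 0) (hm : 0 < m)
    (hx₀ : x₀ ∈ Ioc (0 : ℝ) 1) (hfx : f x₀ ≤ 0) :
    ∃ d ∈ Ioc 0 x₀, f d = 0 ∧ ∀ x ∈ Ioo 0 d, 0 < f x := by
  obtain ⟨δ, hδ, hδf⟩ : ∃ δ > 0, ∀ x ∈ Ioo 0 δ, 0 < f x := by
    have h1 : HasDerivWithinAt f m (Ioo 0 1) 0 := hf0.mono Ioo_subset_Icc_self
    rw [hasDerivWithinAt_iff_tendsto_slope' (by simp), nhdsWithin_Ioo_eq_nhdsGT one_pos] at h1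
    obtain ⟨δ, hδ, hs⟩ := mem_nhdsGT_iff_exists_Ioo_subset.mp (h1.eventually (lt_mem_nhds hm))
    refine ⟨δ, hδ, fun x hx => ?_⟩
    have := hs hx
    simp only [mem_ofPred_eq, slope_def_field, h0, sub_zero] at this
    exact (div_pos_iff_of_pos_right hx.1).mp this
  have hδx : δ ≤ x₀ := by
    by_contra! hlt
    exact absurd (hδf x₀ ⟨hx₀.1, hlt⟩) hfx.not_gt
  have hsub : Icc (δ / 2) x₀ ⊆ Icc 0 1 := Icc_subset_Icc (by positivity) hx₀.2
  obtain ⟨d, ⟨hd, hfd⟩, hmin⟩ :=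
    (isCompact_Icc.of_isClosed_subset
      ((hf.mono hsub).preimage_isClosed_of_isClosed isClosed_Icc (isClosed_Iic (a := 0)))
      inter_subset_left).exists_isLeast ⟨x₀, ⟨by linarith, le_rfl⟩, hfx⟩
  have hd0 : 0 < d := by linarith [hd.1]
  have hpos : ∀ x ∈ Ioo 0 d, 0 < f x := by
    intro x hx
    by_contra! hle
    rcases lt_or_ge x δ with hxδ | hxδ
    · exact absurd (hδf x ⟨hx.1, hxδ⟩) hle.not_gt
    · exact absurd (hmin ⟨⟨by linarith, by linarith [hx.2, hd.2]⟩, hle⟩) hx.2.not_ge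
  refine ⟨d, ⟨hd0, hd.2⟩, le_antisymm hfd ?_, hpos⟩
  have hc : ContinuousWithinAt f (Ioo 0 d) d :=
    (hf d (hsub hd)).mono fun x hx => ⟨hx.1.le, by linarith [hx.2, hd.2, hx₀.2]⟩
  have : (nhdsWithin d (Ioo 0 d)).NeBot := by
    rw [nhdsWithin_Ioo_eq_nhdsLT hd0]; infer_instance
  refine ge_of_tendsto hc ?_
  filter_upwards [self_mem_nhdsWithin] with x hx using (hpos x hx).le

/-- Sturm comparison: a solution of `u'' = a u` that leaves `0` upwards stays positive as long as
some solution of `y'' = b y` with `b ≤ a` does. -/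
theorem IsSturmSolution.pos_of_comparison {a b u v y w : ℝ → ℝ} {e : ℝ}
    (h : IsSturmSolution a u v) (h' : IsSturmSolution b y w) (he : e ≤ 1)
    (hab : ∀ x ∈ Icc (0 : ℝ) e, b x ≤ a x) (hu : u 0 = 0) (hv : 0 < v 0)
    (hy : ∀ x ∈ Ico 0 e, 0 < y x) (hye : 0 ≤ y e) : ∀ x ∈ Ioc 0 e, 0 < u x := by
  intro x hx
  by_contra! hle
  obtain ⟨d, hd, hud, hpos⟩ := exists_first_zero h.continuousOn_fst (h.fst_deriv 0 (by simp)) hu hv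
    ⟨hx.1, hx.2.trans he⟩ hle
  have hde : d ≤ e := hd.2.trans hx.2
  have hd1 : d ≤ 1 := hde.trans he
  have hvd : v d ≤ 0 := nonpos_of_hasDerivWithinAt_of_nonneg_left hd.1 hd1
    (h.fst_deriv d ⟨hd.1.le, hd1⟩) hud fun t ht => (hpos t ht).le
  have hyd : 0 ≤ y d := by
    rcases hde.lt_or_eq with hlt | rfl
    · exact (hy d ⟨hd.1.le, hlt⟩).le
    · exact hye
  have hW := h.wronskian h'
  have hmono : MonotoneOn (fun x => v x * y x - u x * w x) (Icc 0 d) := by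
    refine monotoneOn_of_hasDerivWithinAt_nonneg (convex_Icc _ _)
      (f' := fun x => (a x - b x) * (u x * y x))
      (fun t ht => ((hW t ⟨ht.1, ht.2.trans hd1⟩).continuousWithinAt).mono
        (Icc_subset_Icc_right hd1)) (fun t ht => ?_) (fun t ht => ?_)
    · rw [interior_Icc] at ht ⊢
      exact (hW t ⟨ht.1.le, ht.2.le.trans hd1⟩).mono fun s hs => ⟨hs.1.le, hs.2.le.trans hd1⟩
    · rw [interior_Icc] at ht
      exact mul_nonneg (sub_nonneg.mpr (hab t ⟨ht.1.le, ht.2.le.trans hde⟩))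
        (mul_nonneg (hpos t ht).le (hy t ⟨ht.1.le, ht.2.trans_le hde⟩).le)
  have := hmono (left_mem_Icc.mpr hd.1.le) (right_mem_Icc.mpr hd.1.le) hd.1.le
  simp only [hu, hud, zero_mul, sub_zero] at this
  have h1 := mul_pos hv (hy 0 ⟨le_rfl, hd.1.trans_le hde⟩)
  have h2 := mul_nonpos_of_nonpos_of_nonneg hvd hyd
  linarith

/-- If `a < b` on `(0,1)` and both solutions are positive there, the Wronskian decreases. -/
theorem IsSturmSolution.wronskian_lt {a b u v y w : ℝ → ℝ}
    (h : IsSturmSolution a u v) (h' : IsSturmSolution b y w)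
    (hab : ∀ x ∈ Ioo (0 : ℝ) 1, a x < b x) (hu : ∀ x ∈ Ioo (0 : ℝ) 1, 0 < u x)
    (hy : ∀ x ∈ Ioo (0 : ℝ) 1, 0 < y x) :
    v 1 * y 1 - u 1 * w 1 < v 0 * y 0 - u 0 * w 0 := by
  have hW := h.wronskian h'
  have hanti : StrictAntiOn (fun x => v x * y x - u x * w x) (Icc 0 1) := by
    refine strictAntiOn_of_hasDerivWithinAt_neg (convex_Icc _ _)
      (f' := fun x => (a x - b x) * (u x * y x))
      (fun t ht => (hW t ht).continuousWithinAt) (fun t ht => ?_) (fun t ht => ?_)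
    · exact (hW t (interior_subset ht)).mono interior_subset
    · rw [interior_Icc] at ht
      exact mul_neg_of_neg_of_pos (sub_neg.mpr (hab t ht)) (mul_pos (hu t ht) (hy t ht))
  exact hanti (by simp) (by simp) one_pos

/-! ### The initial value problem by Volterra operators -/

/-- The constant extension of `g ∈ C([0,1])` to `ℝ`. -/
noncomputable abbrev extendUnit (g : C(Icc (0 : ℝ) 1, ℝ)) : ℝ → ℝ := IccExtend zero_le_one g

theorem continuous_extendUnit (g : C(Icc (0 : ℝ) 1, ℝ)) : Continuous (extendUnit g) :=
  g.continuous.Icc_extend'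

theorem extendUnit_of_mem (g : C(Icc (0 : ℝ) 1, ℝ)) {x : ℝ} (hx : x ∈ Icc (0 : ℝ) 1) :
    extendUnit g x = g ⟨x, hx⟩ :=
  IccExtend_of_mem _ _ hx

theorem continuous_primitive_extendUnit (g : C(Icc (0 : ℝ) 1, ℝ)) :
    Continuous fun x : ℝ => ∫ s in (0 : ℝ)..x, extendUnit g s :=
  intervalIntegral.continuous_primitive
    (fun _ _ => (continuous_extendUnit g).intervalIntegrable _ _) _

/-- Integration from `0`, as a bounded operator on `C([0,1])`. -/
noncomputable def volterra : C(Icc (0 : ℝ) 1, ℝ) →L[ℝ] C(Icc (0 : ℝ) 1, ℝ) :=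
  LinearMap.mkContinuous
    { toFun := fun g => ⟨fun x => ∫ s in (0 : ℝ)..x, extendUnit g s,
        (continuous_primitive_extendUnit g).comp continuous_subtype_val⟩
      map_add' := fun g h => by
        ext x
        exact intervalIntegral.integral_add ((continuous_extendUnit g).intervalIntegrable _ _)
          ((continuous_extendUnit h).intervalIntegrable _ _)
      map_smul' := fun k g => by
        ext x
        exact intervalIntegral.integral_const_mul k _ } 1 (by
    intro g
    rw [one_mul, ContinuousMap.norm_le _ (norm_nonneg _)]
    intro x
    have := intervalIntegral.norm_integral_le_of_norm_le_const (a := 0) (b := (x : ℝ))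
      (f := extendUnit g) (C := ‖g‖) (fun s _ => g.norm_coe_le_norm _)
    refine this.trans ?_
    rw [sub_zero, abs_of_nonneg x.2.1]
    exact mul_le_of_le_one_right (norm_nonneg _) x.2.2)

theorem volterra_apply (g : C(Icc (0 : ℝ) 1, ℝ)) (x : Icc (0 : ℝ) 1) :
    volterra g x = ∫ s in (0 : ℝ)..x, extendUnit g s := rfl

theorem abs_volterra_apply_le {g : C(Icc (0 : ℝ) 1, ℝ)} {K : ℝ} {n : ℕ}
    (hg : ∀ x : Icc (0 : ℝ) 1, |g x| ≤ K * (x : ℝ) ^ n) (x : Icc (0 : ℝ) 1) :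
    |volterra g x| ≤ K / (n + 1) * (x : ℝ) ^ (n + 1) := by
  rw [volterra_apply]
  calc |∫ s in (0 : ℝ)..x, extendUnit g s| ≤ ∫ s in (0 : ℝ)..x, |extendUnit g s| :=
        intervalIntegral.abs_integral_le_integral_abs x.2.1
    _ ≤ ∫ s in (0 : ℝ)..x, K * s ^ n := by
        refine intervalIntegral.integral_mono_on x.2.1
          ((continuous_extendUnit g).abs.intervalIntegrable _ _)
          ((by fun_prop : Continuous fun s : ℝ => K * s ^ n).intervalIntegrable _ _) fun s hs => ?_
        have hs' : s ∈ Icc (0 : ℝ) 1 := ⟨hs.1, hs.2.trans x.2.2⟩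
        rw [extendUnit_of_mem g hs']
        exact hg ⟨s, hs'⟩
    _ = K / (n + 1) * (x : ℝ) ^ (n + 1) := by
        rw [intervalIntegral.integral_const_mul, integral_pow]
        simp only [ne_eq, Nat.add_eq_zero_iff, one_ne_zero, and_false, not_false_eq_true, zero_pow,
          sub_zero]
        ring

/-- The operator `g ↦ ∬ a g` of the fixed-point form `u = u(0) + u'(0) x + ∬ a u` of
`u'' = a u`. -/
noncomputable def sturmVolterra (a : C(Icc (0 : ℝ) 1, ℝ)) :
    C(Icc (0 : ℝ) 1, ℝ) →L[ℝ] C(Icc (0 : ℝ) 1, ℝ) :=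
  volterra * (volterra * ContinuousLinearMap.mul ℝ C(Icc (0 : ℝ) 1, ℝ) a)

theorem sturmVolterra_apply (a g : C(Icc (0 : ℝ) 1, ℝ)) :
    sturmVolterra a g = volterra (volterra (a * g)) := rfl

theorem abs_sturmVolterra_pow_le (a g : C(Icc (0 : ℝ) 1, ℝ)) (n : ℕ) (x : Icc (0 : ℝ) 1) :
    |(sturmVolterra a ^ n) g x| ≤ ‖a‖ ^ n / n.factorial * ‖g‖ * (x : ℝ) ^ n := by
  induction n generalizing x with
  | zero => simpa using g.norm_coe_le_norm x
  | succ n ih =>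
    rw [pow_succ', mul_apply_eq_comp, sturmVolterra_apply]
    have h0 : ∀ x : Icc (0 : ℝ) 1, |(a * (sturmVolterra a ^ n) g) x|
        ≤ ‖a‖ * (‖a‖ ^ n / n.factorial * ‖g‖) * (x : ℝ) ^ n := by
      intro x
      rw [ContinuousMap.mul_apply, abs_mul, mul_assoc]
      exact mul_le_mul (a.norm_coe_le_norm x) (ih x) (abs_nonneg _) (norm_nonneg _)
    have h1 := abs_volterra_apply_le (abs_volterra_apply_le h0) x
    refine h1.trans ?_
    have hx := x.2.1
    have hx1 := x.2.2
    rw [Nat.factorial_succ]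
    push_cast
    set B := ‖a‖ ^ (n + 1) / ((n + 1) * n.factorial) * ‖g‖ with hB
    have hB0 : 0 ≤ B := by positivity
    have e : ‖a‖ * (‖a‖ ^ n / n.factorial * ‖g‖) / (n + 1) = B := by
      rw [hB, pow_succ']; field_simp
    rw [e]
    calc B / ((n : ℝ) + 1 + 1) * (x : ℝ) ^ (n + 1 + 1) ≤ B * (x : ℝ) ^ (n + 1) := by
          refine mul_le_mul (div_le_self hB0 (by linarith [n.cast_nonneg (α := ℝ)]))
            (pow_le_pow_of_le_one hx hx1 (by lia)) (by positivity) hB0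

/-- The Volterra operator is quasi-nilpotent, so `1 - sturmVolterra a` is invertible. -/
theorem isUnit_one_sub_sturmVolterra (a : C(Icc (0 : ℝ) 1, ℝ)) :
    IsUnit (1 - sturmVolterra a) := by
  obtain ⟨n, hn⟩ := ((FloorSemiring.tendsto_pow_div_factorial_atTop ‖a‖).eventually
    (gt_mem_nhds one_pos)).exists
  have hT : ‖sturmVolterra a ^ n‖ < 1 := by
    refine lt_of_le_of_lt (ContinuousLinearMap.opNorm_le_bound _ (by positivity) fun g => ?_) hn
    rw [ContinuousMap.norm_le _ (by positivity)]
    intro x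
    refine (abs_sturmVolterra_pow_le a g n x).trans ?_
    exact mul_le_of_le_one_right (by positivity) (pow_le_one₀ x.2.1 x.2.2)
  have hu := isUnit_one_sub_of_norm_lt_one (x := sturmVolterra a ^ n) hT
  rw [← mul_neg_geom_sum] at hu
  refine ((Commute.isUnit_mul_iff ?_).mp hu).1
  exact (mul_neg_geom_sum _ n).trans (geom_sum_mul_neg _ n).symm

/-- The solutions of `u'' = (q - l) u` with initial data `(0, 1)` exist on `[0,1]`, and their value
at `1` depends continuously on the parameter `l`. -/
theorem exists_sturm_shooting {q : ℝ → ℝ} (hq : ContinuousOn q (Icc 0 1)) :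
    ∃ Y Y' : ℝ → ℝ → ℝ, (∀ l, IsSturmSolution (fun x => q x - l) (Y l) (Y' l)) ∧
      (∀ l, Y l 0 = 0) ∧ (∀ l, Y' l 0 = 1) ∧ Continuous fun l => Y l 1 := by
  let Q : C(Icc (0 : ℝ) 1, ℝ) := ⟨_, hq.domRestrict⟩
  let a : ℝ → C(Icc (0 : ℝ) 1, ℝ) := fun l => Q - algebraMap ℝ _ l
  let ι : C(Icc (0 : ℝ) 1, ℝ) := ⟨Subtype.val, continuous_subtype_val⟩
  let y : ℝ → C(Icc (0 : ℝ) 1, ℝ) := fun l => Ring.inverse (1 - sturmVolterra (a l)) ι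
  have hy : ∀ l, y l = ι + sturmVolterra (a l) (y l) := by
    intro l
    have := Ring.mul_inverse_cancel _ (isUnit_one_sub_sturmVolterra (a l))
    have h2 := DFunLike.congr_fun this ι
    rw [mul_apply_eq_comp] at h2
    exact sub_eq_iff_eq_add.mp h2
  have hFTC : ∀ (g : C(Icc (0 : ℝ) 1, ℝ)) (x : ℝ),
      HasDerivAt (fun x => ∫ s in (0 : ℝ)..x, extendUnit g s) (extendUnit g x) x := fun g x =>
    ((continuous_extendUnit g).integral_hasStrictDerivAt 0 x).hasDerivAt
  have hval : ∀ l, ∀ x (hx : x ∈ Icc (0 : ℝ) 1),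
      x + (∫ t in (0 : ℝ)..x, extendUnit (volterra (a l * y l)) t) = y l ⟨x, hx⟩ := by
    intro l x hx
    conv_rhs => rw [hy l]
    rfl
  refine ⟨fun l x => x + ∫ t in (0 : ℝ)..x, extendUnit (volterra (a l * y l)) t,
    fun l x => 1 + ∫ s in (0 : ℝ)..x, extendUnit (a l * y l) s, fun l => ⟨fun x hx => ?_,
    fun x hx => ?_⟩, by simp, by simp, ?_⟩
  · refine (((hasDerivAt_id x).add (hFTC _ x)).congr_deriv ?_).hasDerivWithinAt
    rw [extendUnit_of_mem _ hx]
    rfl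
  · refine (((hFTC _ x).const_add 1).congr_deriv ?_).hasDerivWithinAt
    change _ = (q x - l) * (x + ∫ t in (0 : ℝ)..x, extendUnit (volterra (a l * y l)) t)
    rw [hval l x hx, extendUnit_of_mem _ hx]
    rfl
  · have hc : Continuous y := by
      have hT : Continuous fun l => 1 - sturmVolterra (a l) := by
        have ha : Continuous a := continuous_const.sub (continuous_algebraMap ℝ _)
        exact continuous_const.sub (continuous_const.clm_comp (continuous_const.clm_comp
          ((ContinuousLinearMap.mul ℝ C(Icc (0 : ℝ) 1, ℝ)).continuous.comp ha)))
      have hinv : Continuous fun l => Ring.inverse (1 - sturmVolterra (a l)) := by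
        rw [continuous_iff_continuousAt]
        intro l
        obtain ⟨U, hU⟩ := isUnit_one_sub_sturmVolterra (a l)
        refine ContinuousAt.comp (g := Ring.inverse) (f := fun l => 1 - sturmVolterra (a l)) ?_
          hT.continuousAt
        have := NormedRing.inverse_continuousAt
          (R := C(Icc (0 : ℝ) 1, ℝ) →L[ℝ] C(Icc (0 : ℝ) 1, ℝ)) U
        rwa [hU] at this
      exact hinv.clm_apply continuous_const
    have h1 : (fun l => (1 : ℝ) + ∫ t in (0 : ℝ)..1, extendUnit (volterra (a l * y l)) t)
        = fun l => y l ⟨1, by simp⟩ := funext fun l => hval l 1 (by simp)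
    rw [h1]
    exact (continuous_eval_const _).comp hc

/-! ### The shape of a ground state -/

namespace IsGroundState

variable {μ : ℝ} {φ : ℝ → ℝ}

/-- The derivative of a ground state extends continuously to `[0,1]`, since `φ''` is bounded. -/
theorem exists_isSturmSolution (hφ : IsGroundState μ φ) :
    ∃ p, IsSturmSolution (fun x => μ - φ x ^ 2) φ p := by
  have hgc : ContinuousOn (fun x => μ * φ x - φ x ^ 3) (Icc 0 1) := by
    have := hφ.continuousOn
    fun_prop
  let G : C(Icc (0 : ℝ) 1, ℝ) := ⟨_, hgc.domRestrict⟩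
  have hG : ∀ x ∈ Icc (0 : ℝ) 1, extendUnit G x = μ * φ x - φ x ^ 3 := fun x hx =>
    extendUnit_of_mem G hx
  have hφd : ∀ x ∈ Ioo (0 : ℝ) 1, HasDerivAt φ (deriv φ x) x := fun x hx =>
    ((hφ.contDiffOn.differentiableOn (by norm_num)).differentiableAt
      (isOpen_Ioo.mem_nhds hx)).hasDerivAt
  have hφdd : ∀ x ∈ Ioo (0 : ℝ) 1, HasDerivAt (deriv φ) (extendUnit G x) x := by
    intro x hx
    have h1 : ContDiffOn ℝ 1 (deriv φ) (Ioo 0 1) :=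
      hφ.contDiffOn.deriv_of_isOpen isOpen_Ioo (by norm_num)
    refine ((h1.differentiableOn (by norm_num)).differentiableAt
      (isOpen_Ioo.mem_nhds hx)).hasDerivAt.congr_deriv ?_
    rw [hG x (Ioo_subset_Icc_self hx)]
    linarith [hφ.equation x hx]
  let p : ℝ → ℝ := fun x => deriv φ (1 / 2) + ∫ s in (1 / 2 : ℝ)..x, extendUnit G s
  have hp : ∀ x, HasDerivAt p (extendUnit G x) x := fun x =>
    ((continuous_extendUnit G).integral_hasStrictDerivAt _ x).hasDerivAt.const_add _
  have hpc : Continuous p := continuous_iff_continuousAt.mpr fun x => (hp x).continuousAt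
  have hpφ : ∀ x ∈ Ioo (0 : ℝ) 1, deriv φ x = p x := by
    intro x hx
    have := (convex_Ioo (0 : ℝ) 1).is_const_of_fderivWithin_eq_zero (𝕜 := ℝ)
      (f := fun x => deriv φ x - p x)
      (fun t ht => ((hφdd t ht).sub (hp t)).differentiableAt.differentiableWithinAt)
      (fun t ht => by
        rw [fderivWithin_of_isOpen isOpen_Ioo ht]
        have h0 : HasDerivAt (fun x => deriv φ x - p x) 0 t :=
          ((hφdd t ht).sub (hp t)).congr_deriv (sub_self _)
        rw [h0.hasFDerivAt.fderiv]
        ext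
        simp) hx (by norm_num : (1 / 2 : ℝ) ∈ Ioo 0 1)
    simp only [p, intervalIntegral.integral_same] at this
    simp only [p]
    linarith
  refine ⟨p, fun x hx => ?_, fun x hx => ?_⟩
  · have hdiff : DifferentiableOn ℝ φ (Ioo 0 1) := fun t ht =>
      (hφd t ht).differentiableAt.differentiableWithinAt
    rcases hx.1.eq_or_lt with rfl | h0
    · have hs : Ioo (0 : ℝ) 1 ∈ nhdsWithin 0 (Ioi 0) := Ioo_mem_nhdsGT one_pos
      refine (hasDerivWithinAt_Ici_of_tendsto_deriv hdiff
        ((hφ.continuousOn 0 (by simp)).mono Ioo_subset_Icc_self) hs ?_).mono Icc_subset_Ici_self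
      refine ((hpc.tendsto 0).mono_left nhdsWithin_le_nhds).congr' ?_
      filter_upwards [hs] with t ht using (hpφ t ht).symm
    rcases hx.2.eq_or_lt with rfl | h1
    · have hs : Ioo (0 : ℝ) 1 ∈ nhdsWithin 1 (Iio 1) := Ioo_mem_nhdsLT one_pos
      refine (hasDerivWithinAt_Iic_of_tendsto_deriv hdiff
        ((hφ.continuousOn 1 (by simp)).mono Ioo_subset_Icc_self) hs ?_).mono Icc_subset_Iic_self
      refine ((hpc.tendsto 1).mono_left nhdsWithin_le_nhds).congr' ?_
      filter_upwards [hs] with t ht using (hpφ t ht).symm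
    · exact ((hφd x ⟨h0, h1⟩).congr_deriv (hpφ x ⟨h0, h1⟩)).hasDerivWithinAt
  · refine ((hp x).congr_deriv ?_).hasDerivWithinAt
    rw [hG x hx]
    ring

variable {p : ℝ → ℝ}

/-- Differentiating the equation: `φ'` solves `L₊ φ' = 0` (without boundary conditions). -/
theorem isSturmSolution_deriv (hp : IsSturmSolution (fun x => μ - φ x ^ 2) φ p) :
    IsSturmSolution (fun x => μ - 3 * φ x ^ 2) p (fun x => (μ - φ x ^ 2) * φ x) where
  fst_deriv := hp.snd_deriv
  snd_deriv x hx := ((((hp.fst_deriv x hx).pow 2).const_sub μ).mul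
    (hp.fst_deriv x hx)).congr_deriv (by simp; ring)

/-- Conservation of energy. -/
theorem energy_eq (hφ : IsGroundState μ φ) (hp : IsSturmSolution (fun x => μ - φ x ^ 2) φ p) :
    ∀ x ∈ Icc (0 : ℝ) 1, p x ^ 2 - μ * φ x ^ 2 + φ x ^ 4 / 2 = p 0 ^ 2 := by
  have hd : ∀ x ∈ Icc (0 : ℝ) 1,
      HasDerivWithinAt (fun x => p x ^ 2 - μ * φ x ^ 2 + φ x ^ 4 / 2) 0 (Icc 0 1) x := by
    intro x hx
    have h1 := hp.fst_deriv x hx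
    have h2 := hp.snd_deriv x hx
    exact (((h2.pow 2).sub ((h1.pow 2).const_mul μ)).add ((h1.pow 4).div_const 2)).congr_deriv
      (by simp; ring)
  intro x hx
  have := constant_of_derivWithin_zero (f := fun x => p x ^ 2 - μ * φ x ^ 2 + φ x ^ 4 / 2)
    (a := 0) (b := 1) (fun t ht => (hd t ht).differentiableWithinAt) (fun t ht =>
      (hd t (Ico_subset_Icc_self ht)).derivWithin
        (uniqueDiffOn_Icc one_pos t (Ico_subset_Icc_self ht))) x hx
  simpa [hφ.left_zero] using this

theorem deriv_left_pos (hφ : IsGroundState μ φ)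
    (hp : IsSturmSolution (fun x => μ - φ x ^ 2) φ p) : 0 < p 0 := by
  have hne : p 0 ≠ 0 := fun h0 => by
    have hc : ContinuousOn (fun x => μ - φ x ^ 2) (Icc 0 1) := by
      have := hφ.continuousOn
      fun_prop
    have := hp.eq_zero hc hφ.left_zero h0 (1 / 2) (by norm_num)
    exact (hφ.pos (1 / 2) (by norm_num)).ne' this
  have hr := hp.reflect
  have h1 := nonpos_of_hasDerivWithinAt_of_nonneg_left one_pos le_rfl (hr.fst_deriv 1 (by simp))
    (by simp [hφ.left_zero]) fun x hx =>
      (hφ.pos (1 - x) ⟨by linarith [hx.2], by linarith [hx.1]⟩).le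
  simp only [sub_self, Left.neg_nonpos_iff] at h1
  exact lt_of_le_of_ne h1 hne.symm

theorem deriv_right_neg (hφ : IsGroundState μ φ)
    (hp : IsSturmSolution (fun x => μ - φ x ^ 2) φ p) : p 1 < 0 := by
  have h0 := hφ.deriv_left_pos hp
  have h1 := nonpos_of_hasDerivWithinAt_of_nonneg_left one_pos le_rfl (hp.fst_deriv 1 (by simp))
    hφ.right_zero fun x hx => (hφ.pos x hx).le
  refine lt_of_le_of_ne h1 fun h => ?_
  have := hφ.energy_eq hp 1 (by simp)
  rw [h, hφ.right_zero] at this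
  have h2 : p 0 ^ 2 = 0 := by linarith
  exact h0.ne' (pow_eq_zero_iff (by norm_num) |>.mp h2)

/-- The logarithmic derivative of a ground state decreases: by conservation of energy,
`(φ' / φ)' = -φ² / 2 - φ'(0)² / φ²`. -/
theorem strictAntiOn_logDeriv (hφ : IsGroundState μ φ)
    (hp : IsSturmSolution (fun x => μ - φ x ^ 2) φ p) :
    StrictAntiOn (fun x => p x / φ x) (Ioo 0 1) := by
  have hd : ∀ x ∈ Ioo (0 : ℝ) 1, HasDerivWithinAt (fun x => p x / φ x)
      ((((μ - φ x ^ 2) * φ x) * φ x - p x * p x) / φ x ^ 2) (Ioo 0 1) x := fun x hx =>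
    ((hp.snd_deriv x (Ioo_subset_Icc_self hx)).div (hp.fst_deriv x (Ioo_subset_Icc_self hx))
      (hφ.pos x hx).ne').mono Ioo_subset_Icc_self
  refine strictAntiOn_of_hasDerivWithinAt_neg (convex_Ioo _ _)
    (f' := fun x => (((μ - φ x ^ 2) * φ x) * φ x - p x * p x) / φ x ^ 2)
    (fun t ht => (hd t ht).continuousWithinAt) (fun t ht => ?_) (fun t ht => ?_)
  · rw [interior_Ioo] at ht ⊢
    exact hd t ht
  · rw [interior_Ioo] at ht
    have hpos := hφ.pos t ht
    refine div_neg_of_neg_of_pos ?_ (by positivity)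
    have he := hφ.energy_eq hp t (Ioo_subset_Icc_self ht)
    have h4 : 0 < φ t ^ 4 := by positivity
    nlinarith [sq_nonneg (p 0)]

/-- A ground state increases up to a point `c` and decreases afterwards. -/
theorem exists_max_point (hφ : IsGroundState μ φ)
    (hp : IsSturmSolution (fun x => μ - φ x ^ 2) φ p) :
    ∃ c ∈ Ioo (0 : ℝ) 1, p c = 0 ∧ (∀ x ∈ Ico 0 c, 0 < p x) ∧ ∀ x ∈ Ioc c 1, p x < 0 := by
  have h0 := hφ.deriv_left_pos hp
  have h1 := hφ.deriv_right_neg hp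
  obtain ⟨c, hc, hpc⟩ := intermediate_value_Ioo' zero_le_one hp.continuousOn_snd ⟨h1, h0⟩
  have hanti := hφ.strictAntiOn_logDeriv hp
  refine ⟨c, hc, hpc, fun x hx => ?_, fun x hx => ?_⟩
  · rcases hx.1.eq_or_lt with rfl | hx0
    · exact h0
    · have hx' : x ∈ Ioo (0 : ℝ) 1 := ⟨hx0, hx.2.trans hc.2⟩
      have := hanti hx' hc hx.2
      simp only [hpc, zero_div] at this
      exact (div_pos_iff_of_pos_right (hφ.pos x hx')).mp this
  · rcases hx.2.eq_or_lt with rfl | hx1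
    · exact h1
    · have hx' : x ∈ Ioo (0 : ℝ) 1 := ⟨hc.1.trans hx.1, hx1⟩
      have := hanti hc hx' hx.1
      simp only [hpc, zero_div] at this
      by_contra! hge
      exact absurd (div_nonneg hge (hφ.pos x hx').le) this.not_ge

/-! ### Shooting solutions with nonpositive parameter -/

/-- A shooting solution of `L₊ y = r y` with `r ≤ 0` is positive up to the maximum point of `φ`,
by comparison with `φ'`. -/
theorem shooting_pos_left (hp : IsSturmSolution (fun x => μ - φ x ^ 2) φ p) {c r : ℝ} {y w : ℝ → ℝ}
    (hc : c ∈ Ioo (0 : ℝ) 1) (hpc : p c = 0) (hpl : ∀ x ∈ Ico 0 c, 0 < p x) (hr : r ≤ 0)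
    (hy : IsSturmSolution (fun x => μ - 3 * φ x ^ 2 - r) y w) (hy0 : y 0 = 0) (hw0 : w 0 = 1) :
    ∀ x ∈ Ioc 0 c, 0 < y x :=
  hy.pos_of_comparison (isSturmSolution_deriv hp) hc.2.le (fun x _ => by linarith) hy0
    (by rw [hw0]; exact one_pos) hpl hpc.ge

/-- An eigenfunction of `L₊` with eigenvalue `r ≤ 0` has no zeros in `(0,1)`: comparison with `φ'`
from the left endpoint and with `-φ'` from the right endpoint. -/
theorem eigenfunction_pos (hφ : IsGroundState μ φ) {r : ℝ} {y w : ℝ → ℝ} (hr : r ≤ 0)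
    (hy : IsSturmSolution (fun x => μ - 3 * φ x ^ 2 - r) y w) (hy0 : y 0 = 0) (hw0 : w 0 = 1)
    (hy1 : y 1 = 0) : ∀ x ∈ Ioo (0 : ℝ) 1, 0 < y x := by
  obtain ⟨p, hp⟩ := hφ.exists_isSturmSolution
  obtain ⟨c, hc, hpc, hpl, hpr⟩ := hφ.exists_max_point hp
  have hleft := shooting_pos_left hp hc hpc hpl hr hy hy0 hw0
  have hyc : 0 < y c := hleft c ⟨hc.1, le_rfl⟩
  have hqc : ContinuousOn (fun x => μ - 3 * φ (1 - x) ^ 2 - r) (Icc 0 1) := by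
    have : ContinuousOn (fun x => φ (1 - x)) (Icc 0 1) :=
      hφ.continuousOn.comp (by fun_prop) fun x hx => ⟨by linarith [hx.2], by linarith [hx.1]⟩
    exact (continuousOn_const.sub (continuousOn_const.mul (this.pow 2))).sub continuousOn_const
  have hψ := (isSturmSolution_deriv hp).reflect.const_mul (-1)
  -- Any nonzero multiple of the reflected eigenfunction that leaves `0` upwards is positive.
  have hright : ∀ k : ℝ, 0 < k * -w 1 → ∀ x ∈ Ioc 0 (1 - c), 0 < k * y (1 - x) := by
    intro k hk
    refine (hy.reflect.const_mul k).pos_of_comparison hψ (by linarith [hc.1])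
      (fun x _ => by linarith) (by simp [hy1]) (by simpa using hk) (fun x hx => ?_) (by simp [hpc])
    have := hpr (1 - x) ⟨by linarith [hx.2], by linarith [hx.1]⟩
    linarith
  have hw1 : w 1 ≠ 0 := fun h => by
    have := hy.reflect.eq_zero hqc (by simp [hy1]) (by simp [h]) (1 - c)
      ⟨by linarith [hc.2], by linarith [hc.1]⟩
    rw [sub_sub_cancel] at this
    exact hyc.ne' this
  have hw1' : w 1 < 0 := by
    by_contra! hge
    have := hright (-1) (by
      have := lt_of_le_of_ne hge hw1.symm
      linarith) (1 - c) ⟨by linarith [hc.2], le_rfl⟩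
    rw [sub_sub_cancel] at this
    linarith
  intro x hx
  rcases le_or_gt x c with hxc | hxc
  · exact hleft x ⟨hx.1, hxc⟩
  · have := hright 1 (by linarith) (1 - x) ⟨by linarith [hx.2], by linarith⟩
    rwa [one_mul, sub_sub_cancel] at this

/-- `L₊` has at most one eigenvalue `≤ 0`. -/
theorem eigenvalue_unique (hφ : IsGroundState μ φ) {r s : ℝ} {y w y' w' : ℝ → ℝ}
    (hr : r ≤ 0) (hs : s ≤ 0)
    (hy : IsSturmSolution (fun x => μ - 3 * φ x ^ 2 - r) y w) (hy0 : y 0 = 0) (hw0 : w 0 = 1)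
    (hy1 : y 1 = 0)
    (hy' : IsSturmSolution (fun x => μ - 3 * φ x ^ 2 - s) y' w') (hy0' : y' 0 = 0)
    (hw0' : w' 0 = 1) (hy1' : y' 1 = 0) : r = s := by
  have hpos := hφ.eigenfunction_pos hr hy hy0 hw0 hy1
  have hpos' := hφ.eigenfunction_pos hs hy' hy0' hw0' hy1'
  rcases lt_trichotomy r s with h | h | h
  · have := hy'.wronskian_lt hy (fun x _ => by linarith) hpos' hpos
    simp [hy0, hy0', hy1, hy1'] at this
  · exact h
  · have := hy.wronskian_lt hy' (fun x _ => by linarith) hpos hpos'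
    simp [hy0, hy0', hy1, hy1'] at this

/-- The solution of `L₊ y = 0` with initial data `(0, 1)` is negative at `1`. -/
theorem shooting_zero_neg (hφ : IsGroundState μ φ) {y w : ℝ → ℝ}
    (hy : IsSturmSolution (fun x => μ - 3 * φ x ^ 2) y w) (hy0 : y 0 = 0) (hw0 : w 0 = 1) :
    y 1 < 0 := by
  obtain ⟨p, hp⟩ := hφ.exists_isSturmSolution
  obtain ⟨c, hc, hpc, hpl, hpr⟩ := hφ.exists_max_point hp
  have hp0 := hφ.deriv_left_pos hp
  have hp1 := hφ.deriv_right_neg hp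
  have hleft := shooting_pos_left hp hc hpc hpl le_rfl (hy.congr_coeff fun x => by ring) hy0 hw0
  by_contra! hge
  have hsub : Ioc c 1 ⊆ Icc 0 1 := fun x hx => ⟨hc.1.le.trans hx.1.le, hx.2⟩
  -- The Wronskian of `y` and `φ'` is the constant `φ'(0) > 0`, so `y / φ'` increases right of `c`.
  have hW := hy.wronskian (isSturmSolution_deriv hp)
  have hWc : ∀ x ∈ Icc (0 : ℝ) 1, w x * p x - y x * ((μ - φ x ^ 2) * φ x) = p 0 := by
    intro x hx
    have := constant_of_derivWithin_zero
      (f := fun x => w x * p x - y x * ((μ - φ x ^ 2) * φ x))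
      (a := 0) (b := 1) (fun t ht => (hW t ht).differentiableWithinAt) (fun t ht => by
        rw [(hW t (Ico_subset_Icc_self ht)).derivWithin
          (uniqueDiffOn_Icc one_pos t (Ico_subset_Icc_self ht))]
        ring) x hx
    simpa [hy0, hw0] using this
  have hmono : StrictMonoOn (fun x => y x / p x) (Ioc c 1) := by
    have hd : ∀ x ∈ Ioc c 1, HasDerivWithinAt (fun x => y x / p x)
        ((w x * p x - y x * ((μ - φ x ^ 2) * φ x)) / p x ^ 2) (Ioc c 1) x := fun x hx =>
      ((hy.fst_deriv x (hsub hx)).div (hp.snd_deriv x (hsub hx)) (hpr x hx).ne).mono hsub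
    refine strictMonoOn_of_hasDerivWithinAt_pos (convex_Ioc _ _)
      (f' := fun x => (w x * p x - y x * ((μ - φ x ^ 2) * φ x)) / p x ^ 2)
      (fun t ht => (hd t ht).continuousWithinAt)
      (fun t ht => (hd t (interior_subset ht)).mono interior_subset) (fun t ht => ?_)
    have ht' := interior_subset ht
    have := (hpr t ht').ne
    rw [hWc t (hsub ht')]
    positivity
  have hpos : ∀ x ∈ Ioo (0 : ℝ) 1, 0 < y x := by
    intro x hx
    rcases le_or_gt x c with hxc | hxc
    · exact hleft x ⟨hx.1, hxc⟩
    · have h1 := hmono ⟨hxc, hx.2.le⟩ ⟨hc.2, le_rfl⟩ hx.2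
      have h2 : y 1 / p 1 ≤ 0 := div_nonpos_of_nonneg_of_nonpos hge hp1.le
      have h3 : y x / p x < 0 := h1.trans_le h2
      by_contra! hle
      exact absurd (div_nonneg_of_nonpos hle (hpr x ⟨hxc, hx.2.le⟩).le) h3.not_ge
  have := hy.wronskian_lt hp (fun x hx => by
    have := pow_pos (hφ.pos x hx) 2
    linarith) hpos hφ.pos
  simp only [hφ.left_zero, hφ.right_zero, hy0, mul_zero, zero_mul, sub_zero, zero_sub,
    Left.neg_neg_iff] at this
  exact absurd (mul_nonpos_of_nonneg_of_nonpos hge hp1.le) this.not_ge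

theorem continuousOn_potential (hφ : IsGroundState μ φ) :
    ContinuousOn (fun x => μ - 3 * φ x ^ 2) (Icc 0 1) := by
  have := hφ.continuousOn
  fun_prop

/-- `L₊` has a negative eigenvalue: the shooting function `l ↦ y_l(1)` is negative at `0` and
positive for `l` below the infimum of the potential. -/
theorem exists_neg_eigenvalue (hφ : IsGroundState μ φ) {Y Y' : ℝ → ℝ → ℝ}
    (hY : ∀ l, IsSturmSolution (fun x => μ - 3 * φ x ^ 2 - l) (Y l) (Y' l))
    (hY0 : ∀ l, Y l 0 = 0) (hY0' : ∀ l, Y' l 0 = 1) (hYc : Continuous fun l => Y l 1) :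
    ∃ r < 0, Y r 1 = 0 := by
  obtain ⟨C, hC⟩ := isCompact_Icc.exists_bound_of_continuousOn hφ.continuousOn_potential
  have hC0 : 0 ≤ C := (norm_nonneg _).trans (hC 0 (by simp))
  have h0 : Y 0 1 < 0 :=
    hφ.shooting_zero_neg ((hY 0).congr_coeff fun x => sub_zero _) (hY0 0) (hY0' 0)
  -- For `l = -C` the coefficient is nonnegative: compare with the constant solution of `u'' = 0`.
  have hone : IsSturmSolution (fun _ : ℝ => (0 : ℝ)) (fun _ => 1) (fun _ => 0) :=
    ⟨fun x _ => hasDerivWithinAt_const _ _ _,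
      fun x _ => (hasDerivWithinAt_const _ _ _).congr_deriv (by simp)⟩
  have h1 : 0 < Y (-C) 1 := (hY (-C)).pos_of_comparison hone le_rfl (fun x hx => by
    have := neg_le_of_abs_le (hC x hx)
    linarith) (hY0 _) (by rw [hY0']; exact one_pos) (fun _ _ => one_pos) zero_le_one 1 (by simp)
  obtain ⟨r, hr, hr0⟩ := intermediate_value_Ioo' (neg_nonpos.mpr hC0 : -C ≤ 0)
    hYc.continuousOn ⟨h0, h1⟩
  exact ⟨r, hr.2, hr0⟩

end IsGroundState

/-! ### Eigenfunctions as classical solutions -/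

/-- A primitive of the continuous function `a U` is differentiable everywhere, so a weak solution is
a classical one. -/
theorem IsSturmSolution.of_continuousOn_primitive {a U V : ℝ → ℂ} (ha : ContinuousOn a (Icc 0 1))
    (hU : ∀ x ∈ Icc (0 : ℝ) 1, HasDerivWithinAt U (V x) (Icc 0 1) x)
    (hV : ∀ x ∈ Icc (0 : ℝ) 1, V x = V 0 + ∫ s in (0 : ℝ)..x, a s * U s) :
    IsSturmSolution a U V where
  fst_deriv := hU
  snd_deriv x hx := by
    have hUc : ContinuousOn U (Icc 0 1) := fun t ht => (hU t ht).continuousWithinAt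
    have hc : ContinuousOn (fun s => a s * U s) (Icc 0 1) := ha.mul hUc
    have : Fact (x ∈ Icc (0 : ℝ) 1) := ⟨hx⟩
    have hI : HasDerivWithinAt (fun t => ∫ s in (0 : ℝ)..t, a s * U s) (a x * U x) (Icc 0 1) x :=
      intervalIntegral.integral_hasDerivWithinAt_right
        ((hc.mono (by rw [uIcc_of_le hx.1]; exact Icc_subset_Icc_right hx.2)).intervalIntegrable)
        (hc.stronglyMeasurableAtFilter_nhdsWithin measurableSet_Icc x) (hc x hx)
    exact (hI.const_add (V 0)).congr hV (hV x hx)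

theorem IsSturmSolution.snd_eq_primitive {a U V : ℝ → ℂ} (h : IsSturmSolution a U V)
    (ha : ContinuousOn a (Icc 0 1)) :
    ∀ x ∈ Icc (0 : ℝ) 1, V x = V 0 + ∫ s in (0 : ℝ)..x, a s * U s := by
  intro x hx
  have hc : ContinuousOn (fun s => a s * U s) (Icc 0 1) := ha.mul h.continuousOn_fst
  have hsub : Icc 0 x ⊆ Icc (0 : ℝ) 1 := Icc_subset_Icc_right hx.2
  rw [intervalIntegral.integral_eq_sub_of_hasDerivAt_of_le hx.1 (h.continuousOn_snd.mono hsub)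
    (fun t ht => (h.snd_deriv t ⟨ht.1.le, ht.2.le.trans hx.2⟩).hasDerivAt
      (Icc_mem_nhds ht.1 (ht.2.trans_le hx.2)))
    ((hc.mono (by rwa [uIcc_of_le hx.1])).intervalIntegrable)]
  ring

theorem memLp_of_continuousOn_Icc {f : ℝ → ℂ} (hf : ContinuousOn f (Icc 0 1)) :
    MemLp f 2 unitMeasure := by
  obtain ⟨C, hC⟩ := isCompact_Icc.exists_bound_of_continuousOn hf
  refine MemLp.of_bound
    ((hf.mono Ioo_subset_Icc_self).aestronglyMeasurable measurableSet_Ioo) C ?_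
  filter_upwards [ae_restrict_mem measurableSet_Ioo] with x hx using hC x (Ioo_subset_Icc_self hx)

theorem integral_congr_of_ae_unitMeasure {f g : ℝ → ℂ} (h : ∀ᵐ x ∂unitMeasure, f x = g x) {x : ℝ}
    (hx : x ∈ Icc (0 : ℝ) 1) : ∫ s in (0 : ℝ)..x, f s = ∫ s in (0 : ℝ)..x, g s := by
  rw [intervalIntegral.integral_of_le hx.1, intervalIntegral.integral_of_le hx.1,
    integral_Ioc_eq_integral_Ioo, integral_Ioc_eq_integral_Ioo]
  exact integral_congr_ae (ae_restrict_of_ae_restrict_of_subset (Ioo_subset_Ioo le_rfl hx.2) h)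

theorem LPlus_mem_domain_iff {μ : ℝ} {φ : ℝ → ℝ} (hφ : ContinuousOn φ (Icc 0 1)) (u : L2Unit) :
    u ∈ (LPlus μ φ).domain ↔ ∃ w, HasDirichletSecondDeriv u w := by
  rw [LPlus_domain_eq hφ, LinearPMap.mem_domain_iff, dirichletSecondDeriv_graph]
  rfl

/-- The action of `L₊` on its domain, in terms of representatives. -/
theorem LPlus_apply_ae {μ : ℝ} {φ : ℝ → ℝ} {u w : L2Unit} (hu : u ∈ (LPlus μ φ).domain)
    (hw : HasDirichletSecondDeriv u w) :
    ∀ᵐ x ∂unitMeasure, (LPlus μ φ ⟨u, hu⟩ : L2Unit) x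
      = -w x + ((μ - 3 * φ x ^ 2 : ℝ) : ℂ) * u x := by
  have hw' : (u, w) ∈ dirichletSecondDeriv.graph := by
    rw [dirichletSecondDeriv_graph]; exact hw
  have hu' : u ∈ dirichletSecondDeriv.domain := hu.1
  have hD : dirichletSecondDeriv ⟨u, hu'⟩ = w := ((LinearPMap.image_iff hu').mpr hw').symm
  have e : (LPlus μ φ ⟨u, hu⟩ : L2Unit)
      = -w + MemLp.toLp (fun x => ((μ - 3 * φ x ^ 2 : ℝ) : ℂ) * u x) hu.2 := by
    rw [← hD]; rfl
  rw [e]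
  filter_upwards [Lp.coeFn_add (-w)
    (MemLp.toLp (fun x => ((μ - 3 * φ x ^ 2 : ℝ) : ℂ) * u x) hu.2), Lp.coeFn_neg w,
    MemLp.coeFn_toLp (μ := unitMeasure) (p := 2) hu.2] with x h1 h2 h3
  rw [h1, Pi.add_apply, h2, h3, Pi.neg_apply]

/-- Eigenfunctions of `L₊` are the classical solutions of `-U'' + (μ - 3 φ²) U = z U` with zero
boundary values. -/
theorem mem_eigenspace_LPlus_iff {μ : ℝ} {φ : ℝ → ℝ} (hφ : ContinuousOn φ (Icc 0 1)) (z : ℂ)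
    (u : L2Unit) : u ∈ pmapEigenspace (LPlus μ φ) z ↔
      ∃ U V : ℝ → ℂ, (∀ᵐ x ∂unitMeasure, u x = U x) ∧
        IsSturmSolution (fun x => ((μ - 3 * φ x ^ 2 : ℝ) : ℂ) - z) U V ∧ U 0 = 0 ∧ U 1 = 0 := by
  have ha : ContinuousOn (fun x => ((μ - 3 * φ x ^ 2 : ℝ) : ℂ) - z) (Icc 0 1) := by fun_prop
  rw [mem_pmapEigenspace]
  constructor
  · rintro ⟨hu, he⟩
    obtain ⟨w, hw⟩ := (LPlus_mem_domain_iff hφ u).mp hu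
    have hA := LPlus_apply_ae hu hw
    obtain ⟨U, V, hUu, hU, hV, hU0, hU1⟩ := hw
    have hwU : ∀ᵐ x ∂unitMeasure, w x = (((μ - 3 * φ x ^ 2 : ℝ) : ℂ) - z) * U x := by
      rw [he] at hA
      filter_upwards [hA, Lp.coeFn_smul z u, hUu] with x h1 h2 h3
      rw [h2, Pi.smul_apply, smul_eq_mul, h3] at h1
      linear_combination h1
    refine ⟨U, V, hUu, .of_continuousOn_primitive ha hU fun x hx => ?_, hU0, hU1⟩
    rw [hV x hx, integral_congr_of_ae_unitMeasure hwU hx]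
  · rintro ⟨U, V, hUu, hS, hU0, hU1⟩
    have hm := memLp_of_continuousOn_Icc (ha.mul hS.continuousOn_fst)
    have hmU := MemLp.coeFn_toLp hm
    have hw : HasDirichletSecondDeriv u (MemLp.toLp _ hm) := by
      refine ⟨U, V, hUu, hS.fst_deriv, fun x hx => ?_, hU0, hU1⟩
      rw [integral_congr_of_ae_unitMeasure hmU hx]
      exact hS.snd_eq_primitive ha x hx
    have hu := (LPlus_mem_domain_iff (μ := μ) hφ u).mpr ⟨_, hw⟩
    refine ⟨hu, Lp.ext ?_⟩
    filter_upwards [LPlus_apply_ae hu hw, hmU, hUu, Lp.coeFn_smul z u] with x h1 h2 h3 h4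
    rw [h1, h2, h4, Pi.smul_apply, smul_eq_mul, h3, Pi.mul_apply]
    ring

theorem isPMapEigenvalue_iff {H : Type*} [AddCommGroup H] [Module ℂ H] (A : H →ₗ.[ℂ] H) (z : ℂ) :
    IsPMapEigenvalue A z ↔ ∃ u ∈ pmapEigenspace A z, u ≠ 0 := by
  constructor
  · rintro ⟨u, hu, he⟩
    exact ⟨u, (mem_pmapEigenspace A z u).mpr ⟨u.2, he⟩, hu⟩
  · rintro ⟨u, hu, h0⟩
    obtain ⟨h, he⟩ := (mem_pmapEigenspace A z u).mp hu
    exact ⟨⟨u, h⟩, h0, he⟩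

/-! ### Eigenvalues and eigenspaces through shooting -/

/-- Symmetry of the Dirichlet problem: for a real potential `q`, a nonzero solution of
`-U'' + q U = z U` with zero boundary values forces `z` to be real. The Wronskian of `conj U` and
`U` has derivative `(z - conj z) |U|²` and vanishes at both endpoints. -/
theorem IsSturmSolution.im_eq_zero {q : ℝ → ℝ} {z : ℂ} {U V : ℝ → ℂ}
    (h : IsSturmSolution (fun x => (q x : ℂ) - z) U V) (hU0 : U 0 = 0) (hU1 : U 1 = 0)
    (hne : ∃ x ∈ Icc (0 : ℝ) 1, U x ≠ 0) : z.im = 0 := by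
  have hconj : IsSturmSolution (fun x => (q x : ℂ) - (starRingEnd ℂ) z)
      (fun x => (starRingEnd ℂ) (U x)) (fun x => (starRingEnd ℂ) (V x)) :=
    ⟨fun x hx => (h.fst_deriv x hx).star, fun x hx =>
      (h.snd_deriv x hx).star.congr_deriv (by simp)⟩
  have hW := hconj.wronskian h
  have him : ∀ x ∈ Icc (0 : ℝ) 1, HasDerivWithinAt
      (fun x => ((starRingEnd ℂ) (V x) * U x - (starRingEnd ℂ) (U x) * V x).im)
      (2 * z.im * ‖U x‖ ^ 2) (Icc 0 1) x := by
    intro x hx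
    refine (Complex.imCLM.hasFDerivAt.comp_hasDerivWithinAt x (hW x hx)).congr_deriv ?_
    rw [← Complex.normSq_eq_norm_sq]
    simp [Complex.normSq_apply, -mul_eq_mul_right_iff]
    ring
  have hc : ContinuousOn (fun x => 2 * z.im * ‖U x‖ ^ 2) (Icc 0 1) := by
    have := h.continuousOn_fst
    fun_prop
  have hint : ∫ x in (0 : ℝ)..1, 2 * z.im * ‖U x‖ ^ 2 = 0 := by
    rw [intervalIntegral.integral_eq_sub_of_hasDerivAt_of_le zero_le_one
      (fun x hx => (him x hx).continuousWithinAt)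
      (fun t ht => (him t (Ioo_subset_Icc_self ht)).hasDerivAt (Icc_mem_nhds ht.1 ht.2))
      ((hc.mono (by rw [uIcc_of_le zero_le_one])).intervalIntegrable)]
    simp [hU0, hU1]
  rw [intervalIntegral.integral_const_mul] at hint
  obtain ⟨x, hx, hUx⟩ := hne
  have hpos : 0 < ∫ x in (0 : ℝ)..1, ‖U x‖ ^ 2 :=
    intervalIntegral.integral_pos one_pos (h.continuousOn_fst.norm.pow 2)
      (fun _ _ => by positivity) ⟨x, hx, by positivity⟩
  rcases mul_eq_zero.mp hint with h0 | h0
  · linarith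
  · exact absurd h0 hpos.ne'

theorem exists_ne_zero_of_ae_eq {u : L2Unit} {U : ℝ → ℂ} (hu : u ≠ 0)
    (hUu : ∀ᵐ x ∂unitMeasure, u x = U x) : ∃ x ∈ Icc (0 : ℝ) 1, U x ≠ 0 := by
  by_contra! hU
  refine hu ((Lp.eq_zero_iff_ae_eq_zero).mpr ?_)
  filter_upwards [hUu, ae_restrict_mem measurableSet_Ioo] with x h1 hx
  rw [h1, hU x (Ioo_subset_Icc_self hx)]
  rfl

section Eigenspace

variable {μ : ℝ} {φ : ℝ → ℝ} {r : ℝ} {y w : ℝ → ℝ}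

theorem IsPMapEigenvalue.im_eq_zero (hφ : IsGroundState μ φ) {z : ℂ}
    (hz : IsPMapEigenvalue (LPlus μ φ) z) : z.im = 0 := by
  obtain ⟨u, hu, hu0⟩ := (isPMapEigenvalue_iff _ _).mp hz
  obtain ⟨U, V, hUu, hS, hU0, hU1⟩ := (mem_eigenspace_LPlus_iff hφ.continuousOn z u).mp hu
  exact hS.im_eq_zero hU0 hU1 (exists_ne_zero_of_ae_eq hu0 hUu)

theorem ofReal_shooting (hy : IsSturmSolution (fun x => μ - 3 * φ x ^ 2 - r) y w) :
    IsSturmSolution (fun x => ((μ - 3 * φ x ^ 2 : ℝ) : ℂ) - (r : ℂ))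
      (fun x => (y x : ℂ)) (fun x => (w x : ℂ)) :=
  hy.ofReal.congr_coeff fun x => by push_cast; ring

/-- Eigenfunctions are multiples of the shooting solution. -/
theorem exists_eq_mul_of_mem_eigenspace (hφ : IsGroundState μ φ)
    (hy : IsSturmSolution (fun x => μ - 3 * φ x ^ 2 - r) y w) (hy0 : y 0 = 0) (hw0 : w 0 = 1)
    {u : L2Unit} (hu : u ∈ pmapEigenspace (LPlus μ φ) (r : ℂ)) :
    ∃ (k : ℂ) (U : ℝ → ℂ), (∀ᵐ x ∂unitMeasure, u x = U x) ∧ U 1 = 0 ∧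
      ∀ x ∈ Icc (0 : ℝ) 1, U x = k * y x := by
  obtain ⟨U, V, hUu, hS, hU0, hU1⟩ := (mem_eigenspace_LPlus_iff hφ.continuousOn _ u).mp hu
  have hq := hφ.continuousOn_potential
  exact ⟨V 0, U, hUu, hU1, hS.eq_mul_of_left_zero (ofReal_shooting hy) (by fun_prop) hU0
    (by simp [hy0]) (by simp [hw0])⟩

theorem shooting_right_eq_zero (hφ : IsGroundState μ φ)
    (hy : IsSturmSolution (fun x => μ - 3 * φ x ^ 2 - r) y w) (hy0 : y 0 = 0) (hw0 : w 0 = 1)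
    (hr : IsPMapEigenvalue (LPlus μ φ) (r : ℂ)) : y 1 = 0 := by
  obtain ⟨u, hu, hu0⟩ := (isPMapEigenvalue_iff _ _).mp hr
  obtain ⟨k, U, hUu, hU1, hUk⟩ := exists_eq_mul_of_mem_eigenspace hφ hy hy0 hw0 hu
  obtain ⟨x, hx, hUx⟩ := exists_ne_zero_of_ae_eq hu0 hUu
  have hk : k ≠ 0 := by
    rintro rfl
    exact hUx (by rw [hUk x hx, zero_mul])
  have := hUk 1 (by simp)
  rw [hU1, eq_comm, mul_eq_zero, or_iff_right hk] at this
  exact Complex.ofReal_eq_zero.mp this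

/-- When the shooting solution vanishes at `1`, its class in `L²` is nonzero and spans the
eigenspace. -/
theorem exists_span_eigenspace (hφ : IsGroundState μ φ)
    (hy : IsSturmSolution (fun x => μ - 3 * φ x ^ 2 - r) y w) (hy0 : y 0 = 0) (hw0 : w 0 = 1)
    (hy1 : y 1 = 0) :
    ∃ u ∈ pmapEigenspace (LPlus μ φ) (r : ℂ), u ≠ 0 ∧
      ∀ u' ∈ pmapEigenspace (LPlus μ φ) (r : ℂ), ∃ k : ℂ, k • u = u' := by
  have hS := ofReal_shooting hy
  have hm := memLp_of_continuousOn_Icc hS.continuousOn_fst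
  have hmy := MemLp.coeFn_toLp hm
  refine ⟨MemLp.toLp _ hm, (mem_eigenspace_LPlus_iff hφ.continuousOn _ _).mpr
    ⟨_, _, hmy, hS, by simp [hy0], by simp [hy1]⟩, fun h0 => ?_, fun u' hu' => ?_⟩
  · -- A continuous representative of `0` vanishes identically, but `y'(0) = 1`.
    have hae : y =ᵐ[volume.restrict (Icc (0 : ℝ) 1)] fun _ => (0 : ℝ) := by
      rw [← restrict_Ioo_eq_restrict_Icc]
      rw [h0] at hmy
      filter_upwards [Lp.coeFn_zero ℂ 2 unitMeasure, hmy] with x hx e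
      rw [hx, Pi.zero_apply] at e
      exact_mod_cast e.symm
    have hzero : EqOn y (fun _ => (0 : ℝ)) (Icc 0 1) :=
      Measure.eqOn_Icc_of_ae_eq volume (zero_ne_one' ℝ) hae hy.continuousOn_fst continuousOn_const
    have := (uniqueDiffOn_Icc (zero_lt_one' ℝ) 0 (by simp)).eq_deriv _
      (hy.fst_deriv 0 (by simp))
      ((hasDerivWithinAt_const 0 (Icc (0 : ℝ) 1) (0 : ℝ)).congr hzero hy0)
    rw [hw0] at this
    exact one_ne_zero this
  · obtain ⟨k, U, hUu, -, hUk⟩ := exists_eq_mul_of_mem_eigenspace hφ hy hy0 hw0 hu'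
    refine ⟨k, Lp.ext ?_⟩
    filter_upwards [Lp.coeFn_smul k (MemLp.toLp _ hm), hmy, hUu,
      ae_restrict_mem measurableSet_Ioo] with x h1 h2 h3 hx
    rw [h1, Pi.smul_apply, h2, h3, hUk x (Ioo_subset_Icc_self hx), smul_eq_mul]

end Eigenspace

theorem mainTheorem5 (μ : ℝ) (hμ : -(Real.pi ^ 2) < μ) (φ : ℝ → ℝ) (hφ : IsGroundState μ φ) :
    (∃ ev : ℝ, ev < 0 ∧ IsPMapEigenvalue (LPlus μ φ) (ev : ℂ) ∧
      Module.finrank ℂ (pmapEigenspace (LPlus μ φ) (ev : ℂ)) = 1 ∧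
      ∀ z : ℂ, IsPMapEigenvalue (LPlus μ φ) z → z ≠ (ev : ℂ) → ∃ r : ℝ, 0 < r ∧ z = (r : ℂ)) ∧
    LinearMap.ker (LPlus μ φ).toFun = ⊥ := by
  obtain ⟨Y, Y', hY, hY0, hY0', hYc⟩ := exists_sturm_shooting hφ.continuousOn_potential
  obtain ⟨ev, hev, hYev⟩ := hφ.exists_neg_eigenvalue hY hY0 hY0' hYc
  have huniq : ∀ r : ℝ, r ≤ 0 → IsPMapEigenvalue (LPlus μ φ) (r : ℂ) → r = ev := fun r hr he =>
    hφ.eigenvalue_unique hr hev.le (hY r) (hY0 r) (hY0' r)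
      (shooting_right_eq_zero hφ (hY r) (hY0 r) (hY0' r) he) (hY ev) (hY0 ev) (hY0' ev) hYev
  obtain ⟨u, hu, hu0, hspan⟩ := exists_span_eigenspace hφ (hY ev) (hY0 ev) (hY0' ev) hYev
  refine ⟨⟨ev, hev, (isPMapEigenvalue_iff _ _).mpr ⟨u, hu, hu0⟩, ?_, fun z hz hne => ?_⟩, ?_⟩
  · refine finrank_eq_one_iff'.mpr ⟨⟨u, hu⟩, fun h => hu0 (congrArg Subtype.val h), fun u' => ?_⟩
    obtain ⟨k, hk⟩ := hspan u' u'.2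
    exact ⟨k, Subtype.ext hk⟩
  · have hre : z = (z.re : ℂ) := Complex.ext rfl (by simpa using hz.im_eq_zero hφ)
    refine ⟨z.re, ?_, hre⟩
    by_contra! hle
    rw [hre] at hz
    exact hne (hre.trans (by rw [huniq _ hle hz]))
  · refine LinearMap.ker_eq_bot'.mpr fun v hv => ?_
    by_contra hv0
    have : IsPMapEigenvalue (LPlus μ φ) ((0 : ℝ) : ℂ) :=
      ⟨v, fun h => hv0 (Subtype.ext h), by
        rw [Complex.ofReal_zero, zero_smul]
        exact hv⟩
    exact hev.ne (huniq 0 le_rfl this).symm
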